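/- Vector inequalities are componentwise, and $\mathrm{PSD}$ is the cone of symmetric positive semidefinite $3\times 3$ real matrices. Let $$\mathcal H=\operatorname{conv}\{(x,xx^T,y,y_1y_2): x,y\in\mathbb R^2,\ 0\le x\le y\in\{0,1\}^2\}.$$ Define $$\mathrm{PER}=\{(a,b,c)\in\mathbb R^3: a^2\le bc,\ 0\le b\le a\le c\},$$ $$\mathrm{RLT}_x=\left\{\begin{pmatrix}\lambda&x^T\\x&X\end{pmatrix}: \lambda\in\mathbb R,\ x\in\mathbb R^2,\ X\in\mathbb R^{2\times2}\text{ symmetric},\ \lambda\ge0,\ 0\le\operatorname{diag}(X)\le x,\ \max\{0,x_1+x_2-\lambda\}\le X_{12}\le\min\{x_1,x_2\}\right\},$$ $$\mathrm{RLT}_y=\{(y,Y_{12})\in\mathbb R^2\times\mathbb R:\max\{0,y_1+y_2-1\}\le Y_{12}\le\min\{y_1,y_2\}\}.$$ Then $\mathcal H$ equals the projection onto $(x,X,y,Y_{12})$ of the set of all $(x,X,y,Y_{12},\alpha,\beta)\in\mathbb R^2\times\mathbb R^{2\times2}\times\mathbb R^2\times\mathbb R\times\mathbb R^2\times\mathbb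 R^2$ satisfying the constraints $$x\le y,$$ $$\begin{pmatrix}Y_{12}&(x-\alpha)^T\\x-\alpha&X-\operatorname{Diag}(\beta)\end{pmatrix}\in\mathrm{PSD}\cap\mathrm{RLT}_x,$$ $$(\alpha_j,\beta_j,y_j-Y_{12})\in\mathrm{PER}\quad\text{for }j=1,2,$$ $$(y,Y_{12})\in\mathrm{RLT}_y,$$ and each of these constraints defines a convex set. -/

import Mathlib

namespace SwitchHull

/-- Vectors in ℝ². The indices 1, 2 of the text are `0`, `1` here. -/
abbrev Vec : Type := Fin 2 → ℝ

/-- Real 2 × 2 matrices. -/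
abbrev Mat : Type := Matrix (Fin 2) (Fin 2) ℝ

/-- The space of tuples `(x, X, y, Y₁₂)`. -/
abbrev Pt : Type := Vec × Mat × Vec × ℝ

/-- The lifted space of tuples `(x, X, y, Y₁₂, α, β)`. -/
abbrev LiftedPt : Type := Vec × Mat × Vec × ℝ × Vec × Vec

/-- `𝓗 = conv {(x, x xᵀ, y, y₁ y₂) : 0 ≤ x ≤ y ∈ {0,1}²}`; vector inequalities are componentwise. -/
def hull : Set Pt :=
  convexHull ℝ {p : Pt | ∃ x y : Vec, 0 ≤ x ∧ x ≤ y ∧ (∀ i, y i = 0 ∨ y i = 1) ∧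
    p = (x, Matrix.vecMulVec x x, y, y 0 * y 1)}

/-- The 3 × 3 block matrix with rows `(lam, xᵀ)` and `(x, X)`. -/
def blockMat (lam : ℝ) (x : Vec) (X : Mat) : Matrix (Fin 3) (Fin 3) ℝ :=
  !![lam, x 0, x 1;
     x 0, X 0 0, X 0 1;
     x 1, X 1 0, X 1 1]

/-- The cone of positive semidefinite (in particular symmetric) 3 × 3 matrices. -/
def PSD : Set (Matrix (Fin 3) (Fin 3) ℝ) :=
  {M | M.PosSemidef}

/-- The perspective cone in ℝ³. -/
def PER : Set (ℝ × ℝ × ℝ) :=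
  {(a, b, c) : ℝ × ℝ × ℝ | a ^ 2 ≤ b * c ∧ 0 ≤ b ∧ b ≤ a ∧ a ≤ c}

/-- The homogenized RLT constraints associated with `0 ≤ x ≤ e`. -/
def RLTx : Set (Matrix (Fin 3) (Fin 3) ℝ) :=
  {M | ∃ (lam : ℝ) (x : Vec) (X : Mat), M = blockMat lam x X ∧ X.IsSymm ∧
    0 ≤ lam ∧ 0 ≤ X.diag ∧ X.diag ≤ x ∧
    max 0 (x 0 + x 1 - lam) ≤ X 0 1 ∧ X 0 1 ≤ min (x 0) (x 1)}

/-- The RLT constraints on `(y, Y₁₂)`. -/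
def RLTy : Set (Vec × ℝ) :=
  {(y, Y12) : Vec × ℝ | max 0 (y 0 + y 1 - 1) ≤ Y12 ∧ Y12 ≤ min (y 0) (y 1)}

/-- The constraint `x ≤ y`. -/
def boundConstraint : Set LiftedPt :=
  {(x, _X, y, _Y12, _α, _β) : LiftedPt | x ≤ y}

/-- The constraint `[[Y₁₂, (x - α)ᵀ], [x - α, X - Diag(β)]] ∈ PSD ∩ RLTx`. -/
def matrixConstraint : Set LiftedPt :=
  {(x, X, _y, Y12, α, β) : LiftedPt | blockMat Y12 (x - α) (X - Matrix.diagonal β) ∈ PSD ∩ RLTx}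

/-- The constraint `(αⱼ, βⱼ, yⱼ - Y₁₂) ∈ PER`. -/
def perspectiveConstraint (j : Fin 2) : Set LiftedPt :=
  {(_x, _X, y, Y12, α, β) : LiftedPt | (α j, β j, y j - Y12) ∈ PER}

/-- The constraint `(y, Y₁₂) ∈ RLTy`. -/
def indicatorConstraint : Set LiftedPt :=
  {(_x, _X, y, Y12, _α, _β) : LiftedPt | (y, Y12) ∈ RLTy}

/-- The feasible set of the lifted system. -/
def liftedSet : Set LiftedPt :=
  {p | p ∈ boundConstraint ∧ p ∈ matrixConstraint ∧ (∀ j, p ∈ perspectiveConstraint j) ∧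
    p ∈ indicatorConstraint}

/-- The projection of `(x, X, y, Y₁₂, α, β)` onto `(x, X, y, Y₁₂)`. -/
def proj : LiftedPt → Pt :=
  fun (x, X, y, Y12, _α, _β) => (x, X, y, Y12)

end SwitchHull

namespace SwitchHull

/-! ### Points of the hull in coordinates -/

/-! Disjunction on `y`: a point of the hull is a mixture over the four values of `y`, and `y₁y₂`
makes the weights linear: `Y₁₂` for `(1,1)`, `y_j - Y₁₂` for `e_j`, `1 - y₁ - y₂ + Y₁₂` for `0`. The
`RLT_y` inequalities say that these are nonnegative. The slices `e_j` contribute the moments `(α_j,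
β_j)`, described by `PER`; the slice `(1,1)` contributes what remains of `(x, X)`; the slice `0`
contributes nothing.

The core is `mem_hull_of_box`: PSD and RLT inequalities are exact for moments on `[0,1]²`. With mean
and mixed moment fixed, the admissible variances `(u, v)` satisfy `uv ≥ c²` under upper bounds. On
the hyperbola the covariance has rank one and two atoms suffice; at the upper corner the four
vertices do; interpolation fills in the rest.

For the other inclusion, generators lift explicitly and the lifted set is convex. -/

/-- The point `(x, X, y, Y₁₂)` with `X` symmetric, given by its coordinates. -/
def mkPt (a b A B C y₀ y₁ Y : ℝ) : Pt :=
  (![a, b], !![A, C; C, B], ![y₀, y₁], Y)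

theorem combo_mkPt (s t a b A B C y₀ y₁ Y a' b' A' B' C' y₀' y₁' Y' : ℝ) :
    s • mkPt a b A B C y₀ y₁ Y + t • mkPt a' b' A' B' C' y₀' y₁' Y' =
      mkPt (s * a + t * a') (s * b + t * b') (s * A + t * A') (s * B + t * B') (s * C + t * C')
        (s * y₀ + t * y₀') (s * y₁ + t * y₁') (s * Y + t * Y') := by
  simp [mkPt, Matrix.smul_of]

theorem smul_mkPt (s a b A B C y₀ y₁ Y : ℝ) :
    s • mkPt a b A B C y₀ y₁ Y =
      mkPt (s * a) (s * b) (s * A) (s * B) (s * C) (s * y₀) (s * y₁) (s * Y) := by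
  simp [mkPt, Matrix.smul_of]

theorem add_mkPt (a b A B C y₀ y₁ Y a' b' A' B' C' y₀' y₁' Y' : ℝ) :
    mkPt a b A B C y₀ y₁ Y + mkPt a' b' A' B' C' y₀' y₁' Y' =
      mkPt (a + a') (b + b') (A + A') (B + B') (C + C') (y₀ + y₀') (y₁ + y₁') (Y + Y') := by
  simp [mkPt]

theorem convex_hull : Convex ℝ hull := convex_convexHull ℝ _

theorem generator_mem_hull {a b y₀ y₁ : ℝ} (ha : 0 ≤ a) (hb : 0 ≤ b) (ha' : a ≤ y₀) (hb' : b ≤ y₁)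
    (hy₀ : y₀ = 0 ∨ y₀ = 1) (hy₁ : y₁ = 0 ∨ y₁ = 1) :
    mkPt a b (a ^ 2) (b ^ 2) (a * b) y₀ y₁ (y₀ * y₁) ∈ hull := by
  refine subset_convexHull ℝ _ ⟨![a, b], ![y₀, y₁], ?_, ?_, ?_, ?_⟩
  · intro i; fin_cases i <;> simpa
  · intro i; fin_cases i <;> simpa
  · intro i; fin_cases i <;> simpa
  · simp only [mkPt, Prod.mk.injEq, true_and]
    refine ⟨?_, by simp⟩
    ext i j
    fin_cases i <;> fin_cases j <;> simp [Matrix.vecMulVec_apply] <;> ring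

theorem combo_four_mem_hull {w₁ w₂ w₃ w₄ : ℝ} {p₁ p₂ p₃ p₄ : Pt} (h₁ : p₁ ∈ hull) (h₂ : p₂ ∈ hull)
    (h₃ : p₃ ∈ hull) (h₄ : p₄ ∈ hull) (hw₁ : 0 ≤ w₁) (hw₂ : 0 ≤ w₂) (hw₃ : 0 ≤ w₃) (hw₄ : 0 ≤ w₄)
    (hw : w₁ + w₂ + w₃ + w₄ = 1) : w₁ • p₁ + w₂ • p₂ + w₃ • p₃ + w₄ • p₄ ∈ hull := by
  have := convex_hull.sum_mem (t := Finset.univ) (w := ![w₁, w₂, w₃, w₄])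
    (z := ![p₁, p₂, p₃, p₄]) (by intro i _; fin_cases i <;> simpa)
    (by simpa [Fin.sum_univ_four] using hw) (by intro i _; fin_cases i <;> simpa)
  simpa [Fin.sum_univ_four] using this

/-- Along an affine curve, the hull contains every point between two of its points. -/
theorem mem_hull_of_between {f : ℝ → Pt}
    (hf : ∀ s t u v : ℝ, s + t = 1 → f (s * u + t * v) = s • f u + t • f v) {u v z : ℝ}
    (hu : f u ∈ hull) (hv : f v ∈ hull) (huz : u ≤ z) (hzv : z ≤ v) : f z ∈ hull := by
  have hz : z ∈ segment ℝ u v := by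
    rw [segment_eq_Icc (huz.trans hzv)]; exact ⟨huz, hzv⟩
  obtain ⟨s, t, hs, ht, hst, rfl⟩ := hz
  rw [smul_eq_mul, smul_eq_mul, hf s t u v hst]
  exact convex_hull hu hv hs ht hst

theorem mkPt_affine_fst (a b B C y₀ y₁ Y s t u v : ℝ) (hst : s + t = 1) :
    mkPt a b (s * u + t * v) B C y₀ y₁ Y =
      s • mkPt a b u B C y₀ y₁ Y + t • mkPt a b v B C y₀ y₁ Y := by
  rw [combo_mkPt]; simp only [← add_mul, hst, one_mul]

theorem mkPt_affine_snd (a b A C y₀ y₁ Y s t u v : ℝ) (hst : s + t = 1) :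
    mkPt a b A (s * u + t * v) C y₀ y₁ Y =
      s • mkPt a b A u C y₀ y₁ Y + t • mkPt a b A v C y₀ y₁ Y := by
  rw [combo_mkPt]; simp only [← add_mul, hst, one_mul]

/-! ### The convex hull of `{(x, x xᵀ) : x ∈ [0,1]²}` -/

/-- The interval from `max w_i / p_i` to `min q_j / w_j` is nonempty because `w_i w_j ≤ p_i q_j`.
The scale `r` keeps both atoms of `mem_hull_of_two_points` inside the box. -/
theorem exists_radius {p₁ p₂ q₁ q₂ w₁ w₂ : ℝ} (hp₁ : 0 ≤ p₁) (hp₂ : 0 ≤ p₂) (hq₁ : 0 ≤ q₁)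
    (hq₂ : 0 ≤ q₂) (hw₁ : 0 ≤ w₁) (hw₂ : 0 ≤ w₂) (h₁₁ : w₁ * w₁ ≤ p₁ * q₁)
    (h₁₂ : w₁ * w₂ ≤ p₁ * q₂) (h₂₁ : w₂ * w₁ ≤ p₂ * q₁) (h₂₂ : w₂ * w₂ ≤ p₂ * q₂) :
    ∃ r > 0, w₁ ≤ r * p₁ ∧ w₂ ≤ r * p₂ ∧ r * w₁ ≤ q₁ ∧ r * w₂ ≤ q₂ := by
  have key {p q w w' : ℝ} (hp : 0 ≤ p) (hq : 0 ≤ q) (h : w * w' ≤ p * q) : w / p * w' ≤ q := by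
    rcases hp.eq_or_lt with rfl | hp
    · simpa
    · rw [div_mul_eq_mul_div, div_le_iff₀ hp]; linarith
  have key' {p q w : ℝ} (hp : 0 ≤ p) (h : w * w ≤ p * q) : w = w / p * p := by
    rcases hp.eq_or_lt with rfl | hp
    · have : w = 0 := by nlinarith
      simp [this]
    · field_simp
  have hr₁ : w₁ ≤ max (w₁ / p₁) (w₂ / p₂) * p₁ := by
    conv_lhs => rw [key' hp₁ h₁₁]
    exact mul_le_mul_of_nonneg_right (le_max_left _ _) hp₁
  have hr₂ : w₂ ≤ max (w₁ / p₁) (w₂ / p₂) * p₂ := by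
    conv_lhs => rw [key' hp₂ h₂₂]
    exact mul_le_mul_of_nonneg_right (le_max_right _ _) hp₂
  have hr : 0 ≤ max (w₁ / p₁) (w₂ / p₂) := le_max_of_le_left (div_nonneg hw₁ hp₁)
  rcases hr.eq_or_lt with h0 | hpos
  · rw [← h0, zero_mul] at hr₁ hr₂
    obtain rfl : w₁ = 0 := le_antisymm hr₁ hw₁
    obtain rfl : w₂ = 0 := le_antisymm hr₂ hw₂
    exact ⟨1, one_pos, by simpa, by simpa, by simpa, by simpa⟩
  · refine ⟨_, hpos, hr₁, hr₂, ?_, ?_⟩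
    · rcases max_choice (w₁ / p₁) (w₂ / p₂) with h | h <;> rw [h]
      exacts [key hp₁ hq₁ h₁₁, key hp₂ hq₁ h₂₁]
    · rcases max_choice (w₁ / p₁) (w₂ / p₂) with h | h <;> rw [h]
      exacts [key hp₁ hq₂ h₁₂, key hp₂ hq₂ h₂₂]

/-- A two-point distribution on a line has covariance `w wᵀ`. -/
theorem mem_hull_of_two_points {a b r w₁ w₂ : ℝ} (hr : 0 < r)
    (h₁ : 0 ≤ a + r * w₁) (h₂ : a + r * w₁ ≤ 1) (h₃ : 0 ≤ b + r * w₂) (h₄ : b + r * w₂ ≤ 1)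
    (h₅ : 0 ≤ a - w₁ / r) (h₆ : a - w₁ / r ≤ 1) (h₇ : 0 ≤ b - w₂ / r) (h₈ : b - w₂ / r ≤ 1) :
    mkPt a b (a ^ 2 + w₁ ^ 2) (b ^ 2 + w₂ ^ 2) (a * b + w₁ * w₂) 1 1 1 ∈ hull := by
  have g₁ := generator_mem_hull h₁ h₃ h₂ h₄ (Or.inr rfl) (Or.inr rfl)
  have g₂ := generator_mem_hull h₅ h₇ h₆ h₈ (Or.inr rfl) (Or.inr rfl)
  have hr' : 0 < r ^ 2 + 1 := by positivity
  have := convex_hull g₁ g₂ (a := 1 / (r ^ 2 + 1)) (b := r ^ 2 / (r ^ 2 + 1)) (by positivity)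
    (by positivity) (by field_simp; ring)
  rw [combo_mkPt] at this
  convert this using 1
  congr 1 <;> field_simp <;> ring

theorem mem_hull_of_det_eq_zero {a b u v c : ℝ} (ha : 0 ≤ a) (ha' : a ≤ 1) (hb : 0 ≤ b)
    (hb' : b ≤ 1) (hu : 0 ≤ u) (hv : 0 ≤ v) (huv : u * v = c ^ 2) (hua : a ^ 2 + u ≤ a)
    (hvb : b ^ 2 + v ≤ b) (h₀ : 0 ≤ a * b + c) (h₁ : a + b - 1 ≤ a * b + c) (h₂ : a * b + c ≤ a)
    (h₃ : a * b + c ≤ b) :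
    mkPt a b (a ^ 2 + u) (b ^ 2 + v) (a * b + c) 1 1 1 ∈ hull := by
  have hs : √u * √v = |c| := by rw [← Real.sqrt_mul hu, huv, Real.sqrt_sq_eq_abs]
  have hsu : √u * √u = u := Real.mul_self_sqrt hu
  have hsv : √v * √v = v := Real.mul_self_sqrt hv
  have hnu := Real.sqrt_nonneg u
  have hnv := Real.sqrt_nonneg v
  -- For `c ≥ 0` the cross conditions are `c ≤ a(1-b)` and `c ≤ b(1-a)`. For `c ≤ 0`, reflecting the
  -- second coordinate turns them into `-c ≤ ab` and `-c ≤ (1-a)(1-b)`.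
  rcases le_total 0 c with hc | hc
  · rw [abs_of_nonneg hc] at hs
    obtain ⟨r, hr, e₁, e₂, e₃, e₄⟩ := exists_radius (p₁ := a) (p₂ := b) (q₁ := 1 - a) (q₂ := 1 - b)
      ha hb (by linarith) (by linarith) hnu hnv (by linarith) (by linarith) (by linarith)
      (by linarith)
    have d₁ : √u / r ≤ a := by rw [div_le_iff₀ hr]; linarith
    have d₂ : √v / r ≤ b := by rw [div_le_iff₀ hr]; linarith
    have := mem_hull_of_two_points (a := a) (b := b) (w₁ := √u) (w₂ := √v) hr (by positivity)
      (by linarith) (by positivity) (by linarith) (by linarith)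
      (by linarith [div_nonneg hnu hr.le]) (by linarith) (by linarith [div_nonneg hnv hr.le])
    rwa [Real.sq_sqrt hu, Real.sq_sqrt hv, hs] at this
  · rw [abs_of_nonpos hc] at hs
    obtain ⟨r, hr, e₁, e₂, e₃, e₄⟩ := exists_radius (p₁ := a) (p₂ := 1 - b) (q₁ := 1 - a) (q₂ := b)
      ha (by linarith) (by linarith) hb hnu hnv (by linarith) (by linarith) (by linarith)
      (by linarith)
    have d₁ : √u / r ≤ a := by rw [div_le_iff₀ hr]; linarith
    have d₂ : √v / r ≤ 1 - b := by rw [div_le_iff₀ hr]; linarith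
    have := mem_hull_of_two_points (a := a) (b := b) (w₁ := √u) (w₂ := -√v) hr (by positivity)
      (by linarith) (by linarith) (by linarith [mul_nonneg hr.le hnv]) (by linarith)
      (by linarith [div_nonneg hnu hr.le])
      (by rw [neg_div]; linarith [div_nonneg hnv hr.le]) (by rw [neg_div]; linarith)
    rwa [neg_sq, Real.sq_sqrt hu, Real.sq_sqrt hv, mul_neg, hs, neg_neg] at this

/-- The four inequalities are nonnegativity of the weights of the box vertices. -/
theorem mem_hull_of_diag_eq {a b C : ℝ} (h₀ : 0 ≤ C) (h₁ : a + b - 1 ≤ C) (h₂ : C ≤ a)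
    (h₃ : C ≤ b) : mkPt a b a b C 1 1 1 ∈ hull := by
  have g {s t : ℝ} (hs : s = 0 ∨ s = 1) (ht : t = 0 ∨ t = 1) :
      mkPt s t (s ^ 2) (t ^ 2) (s * t) 1 1 (1 * 1) ∈ hull :=
    generator_mem_hull (by rcases hs with rfl | rfl <;> simp) (by rcases ht with rfl | rfl <;> simp)
      (by rcases hs with rfl | rfl <;> simp) (by rcases ht with rfl | rfl <;> simp)
      (Or.inr rfl) (Or.inr rfl)
  have := combo_four_mem_hull (g (.inl rfl) (.inl rfl)) (g (.inr rfl) (.inl rfl))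
    (g (.inl rfl) (.inr rfl)) (g (.inr rfl) (.inr rfl)) (w₁ := 1 - a - b + C) (w₂ := a - C)
    (w₃ := b - C) (w₄ := C) (by linarith) (by linarith) (by linarith) h₀ (by ring)
  simp only [smul_mkPt, add_mkPt] at this
  convert this using 1
  congr 1 <;> ring

/-- For `n = 2`, the semidefinite and RLT constraints describe `conv {(x, x xᵀ) : x ∈ [0,1]²}`. -/
theorem mem_hull_of_box {a b A B C : ℝ} (haA : a ^ 2 ≤ A) (hA : A ≤ a) (hbB : b ^ 2 ≤ B)
    (hB : B ≤ b) (hdet : (C - a * b) ^ 2 ≤ (A - a ^ 2) * (B - b ^ 2)) (h₀ : 0 ≤ C)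
    (h₁ : a + b - 1 ≤ C) (h₂ : C ≤ a) (h₃ : C ≤ b) : mkPt a b A B C 1 1 1 ∈ hull := by
  have ha : 0 ≤ a := by linarith
  have hb : 0 ≤ b := by linarith
  have ha' : a ≤ 1 := by linarith
  have hb' : b ≤ 1 := by linarith
  have hrank {u v : ℝ} (hu : 0 ≤ u) (hv : 0 ≤ v) (huv : u * v = (C - a * b) ^ 2)
      (hua : a ^ 2 + u ≤ a) (hvb : b ^ 2 + v ≤ b) :
      mkPt a b (a ^ 2 + u) (b ^ 2 + v) C 1 1 1 ∈ hull := by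
    have := mem_hull_of_det_eq_zero (c := C - a * b) ha ha' hb hb' hu hv huv hua hvb (by linarith)
      (by linarith) (by linarith) (by linarith)
    rwa [add_sub_cancel] at this
  obtain ⟨u, rfl⟩ : ∃ u, A = a ^ 2 + u := ⟨A - a ^ 2, by ring⟩
  obtain ⟨v, rfl⟩ : ∃ v, B = b ^ 2 + v := ⟨B - b ^ 2, by ring⟩
  rw [add_sub_cancel_left, add_sub_cancel_left] at hdet
  have hu : 0 ≤ u := by linarith
  have hv : 0 ≤ v := by linarith
  -- If `uv = 0`, then `hdet` forces `C = ab`, so the point already lies on the rank-one locus.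
  by_cases h0 : u * v = 0
  · exact hrank hu hv (by nlinarith [sq_nonneg (C - a * b)]) hA hB
  have hu : 0 < u := lt_of_le_of_ne hu fun h => h0 (by simp [← h])
  have hv : 0 < v := lt_of_le_of_ne hv fun h => h0 (by simp [← h])
  have hU : 0 < a - a ^ 2 := by linarith
  have hleft : (C - a * b) ^ 2 / v ≤ u := by rwa [div_le_iff₀ hv]
  have hbot : (C - a * b) ^ 2 / (a - a ^ 2) ≤ v := by
    rw [div_le_iff₀ hU]; nlinarith
  -- `p₁` is on the hyperbola at height `v`, `p₂` is where it meets the edge `A = a`. Moving up that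
  -- edge from `p₂` to the corner gives `p₃` at height `v`; the target lies between `p₁` and `p₃`.
  have p₁ := hrank (u := (C - a * b) ^ 2 / v) (v := v) (by positivity) hv.le (by field_simp)
    (by linarith) hB
  have p₂ := hrank (u := a - a ^ 2) (v := (C - a * b) ^ 2 / (a - a ^ 2)) hU.le (by positivity)
    (by rw [mul_comm, div_mul_cancel₀ _ hU.ne']) (by linarith) (by linarith)
  rw [add_sub_cancel] at p₂
  have p₃ := mem_hull_of_between (f := fun z => mkPt a b a z C 1 1 1) (z := b ^ 2 + v)
    (mkPt_affine_snd a b a C 1 1 1) p₂ (mem_hull_of_diag_eq h₀ h₁ h₂ h₃) (by linarith) hB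
  exact mem_hull_of_between (f := fun z => mkPt a b z (b ^ 2 + v) C 1 1 1) (z := a ^ 2 + u)
    (mkPt_affine_fst a b (b ^ 2 + v) C 1 1 1) p₁ p₃ (by linarith) hA

/-! ### Homogenized pieces of the decomposition -/

theorem zero_mem_hull : mkPt 0 0 0 0 0 0 0 0 ∈ hull := by
  have := generator_mem_hull le_rfl le_rfl le_rfl le_rfl (.inl rfl) (.inl rfl)
  simpa using this

theorem mkPt_zero : mkPt 0 0 0 0 0 0 0 0 = 0 := by
  simpa using (smul_mkPt 0 0 0 0 0 0 0 0 0).symm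

theorem exists_smul_eq_of_box {l a b A B C : ℝ} (hA₀ : 0 ≤ A) (hA : A ≤ a) (hB₀ : 0 ≤ B)
    (hB : B ≤ b) (h₀ : 0 ≤ C) (h₁ : a + b - l ≤ C) (h₂ : C ≤ a) (h₃ : C ≤ b)
    (hpsd : ∀ r s t : ℝ, 0 ≤ l * r ^ 2 + A * s ^ 2 + B * t ^ 2 + 2 * a * r * s + 2 * b * r * t
      + 2 * C * s * t) :
    ∃ p ∈ hull, l • p = mkPt a b A B C l l l := by
  have hl : 0 ≤ l := by linarith
  rcases hl.eq_or_lt with rfl | hl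
  · obtain rfl : a = 0 := by linarith
    obtain rfl : b = 0 := by linarith
    obtain rfl : A = 0 := by linarith
    obtain rfl : B = 0 := by linarith
    obtain rfl : C = 0 := by linarith
    exact ⟨_, zero_mem_hull, by rw [mkPt_zero, smul_zero]⟩
  · have hquad (s t : ℝ) : 0 ≤ (A / l - (a / l) ^ 2) * s ^ 2 + (B / l - (b / l) ^ 2) * t ^ 2
        + 2 * (C / l - a / l * (b / l)) * s * t := by
      -- This `r` minimizes the form, leaving the Schur complement of `l`.
      have := div_nonneg (hpsd (-(a * s + b * t) / l) s t) hl.le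
      refine this.trans_eq ?_
      field_simp
      ring
    have hu := hquad 1 0
    have hv := hquad 0 1
    have hdisc := discrim_le_zero (a := A / l - (a / l) ^ 2)
      (b := 2 * (C / l - a / l * (b / l))) (c := B / l - (b / l) ^ 2)
      fun s => by linarith [hquad s 1]
    rw [discrim] at hdisc
    refine ⟨mkPt (a / l) (b / l) (A / l) (B / l) (C / l) 1 1 1,
      mem_hull_of_box (by linarith) (by gcongr) (by linarith) (by gcongr) (by linarith)
        (by positivity) ?_ (by gcongr) (by gcongr), ?_⟩
    · have := div_le_div_of_nonneg_right h₁ hl.le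
      rw [sub_div, add_div, div_self hl.ne'] at this
      exact this
    · simp only [smul_mkPt, mul_div_cancel₀ _ hl.ne', mul_one]

theorem PER_normalize {a b c : ℝ} (h : (a, b, c) ∈ PER) (hc : 0 < c) :
    0 ≤ a / c ∧ a / c ≤ 1 ∧ (a / c) ^ 2 ≤ b / c ∧ b / c ≤ a / c := by
  obtain ⟨h₁, h₂, h₃, h₄⟩ := h
  refine ⟨div_nonneg (h₂.trans h₃) hc.le, (div_le_one hc).2 h₄, ?_, by gcongr⟩
  rw [div_pow, div_le_div_iff₀ (by positivity) hc]
  nlinarith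

theorem PER_nonneg {a b c : ℝ} (h : (a, b, c) ∈ PER) : 0 ≤ c :=
  h.2.1.trans (h.2.2.1.trans h.2.2.2)

theorem PER_eq_zero {a b : ℝ} (h : (a, b, (0 : ℝ)) ∈ PER) : a = 0 ∧ b = 0 := by
  obtain ⟨-, h₂, h₃, h₄⟩ := h
  constructor <;> linarith

/-- After scaling by `c`, the second moment of a variable in `[0,1]` with mean `m` ranges from `m²`
(one atom) to `m` (atoms 0 and 1). -/
theorem exists_smul_eq_of_PER_fst {a b c : ℝ} (h : (a, b, c) ∈ PER) :
    ∃ p ∈ hull, c • p = mkPt a 0 b 0 0 c 0 0 := by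
  rcases (PER_nonneg h).eq_or_lt with rfl | hc
  · obtain ⟨rfl, rfl⟩ := PER_eq_zero h
    exact ⟨_, zero_mem_hull, by rw [mkPt_zero, smul_zero]⟩
  · obtain ⟨h₁, h₂, h₃, h₄⟩ := PER_normalize h hc
    refine ⟨mkPt (a / c) 0 (b / c) 0 0 1 0 0, ?_, ?_⟩
    · have g₀ := generator_mem_hull h₁ le_rfl h₂ le_rfl (.inr rfl) (.inl rfl)
      have g₁ := convex_hull
        (generator_mem_hull (a := 1) (y₀ := 1) zero_le_one le_rfl le_rfl le_rfl (.inr rfl)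
          (.inl rfl))
        (generator_mem_hull (a := 0) (y₀ := 1) le_rfl le_rfl zero_le_one le_rfl (.inr rfl)
          (.inl rfl)) h₁ (sub_nonneg.2 h₂) (by ring)
      rw [combo_mkPt] at g₁
      norm_num at g₀ g₁
      exact mem_hull_of_between (f := fun z => mkPt (a / c) 0 z 0 0 1 0 0)
        (mkPt_affine_fst _ _ _ _ _ _ _) (by simpa using g₀) (by simpa using g₁) (by simpa using h₃)
        (by simpa using h₄)
    · simp only [smul_mkPt, mul_div_cancel₀ _ hc.ne', mul_one, mul_zero]

theorem exists_smul_eq_of_PER_snd {a b c : ℝ} (h : (a, b, c) ∈ PER) :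
    ∃ p ∈ hull, c • p = mkPt 0 a 0 b 0 0 c 0 := by
  rcases (PER_nonneg h).eq_or_lt with rfl | hc
  · obtain ⟨rfl, rfl⟩ := PER_eq_zero h
    exact ⟨_, zero_mem_hull, by rw [mkPt_zero, smul_zero]⟩
  · obtain ⟨h₁, h₂, h₃, h₄⟩ := PER_normalize h hc
    refine ⟨mkPt 0 (a / c) 0 (b / c) 0 0 1 0, ?_, ?_⟩
    · have g₀ := generator_mem_hull le_rfl h₁ le_rfl h₂ (.inl rfl) (.inr rfl)
      have g₁ := convex_hull
        (generator_mem_hull (b := 1) (y₁ := 1) le_rfl zero_le_one le_rfl le_rfl (.inl rfl)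
          (.inr rfl))
        (generator_mem_hull (b := 0) (y₁ := 1) le_rfl le_rfl le_rfl zero_le_one (.inl rfl)
          (.inr rfl)) h₁ (sub_nonneg.2 h₂) (by ring)
      rw [combo_mkPt] at g₁
      norm_num at g₀ g₁
      exact mem_hull_of_between (f := fun z => mkPt 0 (a / c) 0 z 0 0 1 0)
        (mkPt_affine_snd _ _ _ _ _ _ _) (by simpa using g₀) (by simpa using g₁) (by simpa using h₃)
        (by simpa using h₄)
    · simp only [smul_mkPt, mul_div_cancel₀ _ hc.ne', mul_one, mul_zero]

/-! ### The constraints in coordinates -/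

theorem blockMat_mem_PSD_iff {l : ℝ} {x : Vec} {X : Mat} :
    blockMat l x X ∈ PSD ↔ X 0 1 = X 1 0 ∧ ∀ r s t : ℝ, 0 ≤ l * r ^ 2 + X 0 0 * s ^ 2
      + X 1 1 * t ^ 2 + 2 * x 0 * r * s + 2 * x 1 * r * t + 2 * X 0 1 * s * t := by
  rw [PSD, Set.mem_ofPred_eq, Matrix.posSemidef_iff_dotProduct_mulVec]
  constructor
  · rintro ⟨hH, hM⟩
    have hsymm : X 0 1 = X 1 0 := by simpa [blockMat] using hH.apply 2 1
    refine ⟨hsymm, fun r s t => ?_⟩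
    have := hM ![r, s, t]
    simp [blockMat, Matrix.mulVec, dotProduct, Fin.sum_univ_three, ← hsymm] at this
    linarith
  · rintro ⟨hsymm, hM⟩
    refine ⟨?_, fun z => ?_⟩
    · ext i j
      fin_cases i <;> fin_cases j <;> simp [blockMat, hsymm]
    · have := hM (z 0) (z 1) (z 2)
      simp [blockMat, Matrix.mulVec, dotProduct, Fin.sum_univ_three, ← hsymm]
      linarith

theorem blockMat_mem_RLTx_iff {l : ℝ} {x : Vec} {X : Mat} :
    blockMat l x X ∈ RLTx ↔ X 0 1 = X 1 0 ∧ 0 ≤ l ∧ (0 ≤ X 0 0 ∧ X 0 0 ≤ x 0) ∧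
      (0 ≤ X 1 1 ∧ X 1 1 ≤ x 1) ∧ 0 ≤ X 0 1 ∧ x 0 + x 1 - l ≤ X 0 1 ∧ X 0 1 ≤ x 0 ∧
      X 0 1 ≤ x 1 := by
  constructor
  · rintro ⟨l', x', X', h, hsymm, hl, hd, hd', hm, hM⟩
    have e (i j) := congrFun (congrFun h i) j
    have e₀₀ := e 0 0
    have e₀₁ := e 0 1
    have e₀₂ := e 0 2
    have e₁₁ := e 1 1
    have e₁₂ := e 1 2
    have e₂₁ := e 2 1
    have e₂₂ := e 2 2
    have hs := hsymm.apply 0 1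
    have := hd 0
    have := hd 1
    have := hd' 0
    have := hd' 1
    simp [blockMat] at *
    grind
  · rintro ⟨hs, hl, ⟨h₁, h₂⟩, ⟨h₃, h₄⟩, h₅, h₆, h₇, h₈⟩
    refine ⟨l, x, X, rfl, ?_, hl, ?_, ?_, max_le h₅ h₆, le_min h₇ h₈⟩
    · ext i j
      fin_cases i <;> fin_cases j <;> simp [hs]
    · intro i; fin_cases i <;> simpa
    · intro i; fin_cases i <;> simpa

theorem mem_matrixConstraint_iff {x : Vec} {X : Mat} {y : Vec} {Y : ℝ} {α β : Vec} :
    ((x, X, y, Y, α, β) : LiftedPt) ∈ matrixConstraint ↔ X 0 1 = X 1 0 ∧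
      (∀ r s t : ℝ, 0 ≤ Y * r ^ 2 + (X 0 0 - β 0) * s ^ 2 + (X 1 1 - β 1) * t ^ 2
        + 2 * (x 0 - α 0) * r * s + 2 * (x 1 - α 1) * r * t + 2 * X 0 1 * s * t) ∧ 0 ≤ Y ∧
      (0 ≤ X 0 0 - β 0 ∧ X 0 0 - β 0 ≤ x 0 - α 0) ∧ (0 ≤ X 1 1 - β 1 ∧ X 1 1 - β 1 ≤ x 1 - α 1) ∧
      0 ≤ X 0 1 ∧ (x 0 - α 0) + (x 1 - α 1) - Y ≤ X 0 1 ∧ X 0 1 ≤ x 0 - α 0 ∧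
      X 0 1 ≤ x 1 - α 1 := by
  change blockMat Y (x - α) (X - Matrix.diagonal β) ∈ PSD ∩ RLTx ↔ _
  rw [Set.mem_inter_iff, blockMat_mem_PSD_iff, blockMat_mem_RLTx_iff]
  simp only [Matrix.sub_apply, Pi.sub_apply, Matrix.diagonal_apply_eq,
    Matrix.diagonal_apply_ne _ (show (0 : Fin 2) ≠ 1 by decide),
    Matrix.diagonal_apply_ne _ (show (1 : Fin 2) ≠ 0 by decide), sub_zero]
  tauto

theorem mem_indicatorConstraint_iff {x : Vec} {X : Mat} {y : Vec} {Y : ℝ} {α β : Vec} :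
    ((x, X, y, Y, α, β) : LiftedPt) ∈ indicatorConstraint ↔
      0 ≤ Y ∧ y 0 + y 1 - 1 ≤ Y ∧ Y ≤ y 0 ∧ Y ≤ y 1 := by
  change (max 0 (y 0 + y 1 - 1) ≤ Y ∧ Y ≤ min (y 0) (y 1)) ↔ _
  rw [max_le_iff, le_min_iff, and_assoc]

/-! ### Convexity of the constraints -/

theorem convex_boundConstraint : Convex ℝ boundConstraint := by
  rintro ⟨x, X, y, Y, α, β⟩ hp ⟨x', X', y', Y', α', β'⟩ hq s t hs ht hst
  have hxy : x ≤ y := hp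
  have hxy' : x' ≤ y' := hq
  exact add_le_add (smul_le_smul_of_nonneg_left hxy hs) (smul_le_smul_of_nonneg_left hxy' ht)

theorem convex_matrixConstraint : Convex ℝ matrixConstraint := by
  rintro ⟨x, X, y, Y, α, β⟩ hp ⟨x', X', y', Y', α', β'⟩ hq s t hs ht hst
  rw [mem_matrixConstraint_iff] at hp hq
  obtain ⟨h₀, h₁, h₂, ⟨h₃, h₄⟩, ⟨h₅, h₆⟩, h₇, h₈, h₉, h₁₀⟩ := hp
  obtain ⟨k₀, k₁, k₂, ⟨k₃, k₄⟩, ⟨k₅, k₆⟩, k₇, k₈, k₉, k₁₀⟩ := hq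
  simp only [Prod.smul_mk, Prod.mk_add_mk]
  rw [mem_matrixConstraint_iff]
  have key {u v : ℝ} (hu : 0 ≤ u) (hv : 0 ≤ v) : 0 ≤ s * u + t * v := by positivity
  have key' {u v u' v' : ℝ} (hu : u ≤ u') (hv : v ≤ v') : s * u + t * v ≤ s * u' + t * v' := by
    gcongr
  simp only [Matrix.add_apply, Matrix.smul_apply, Pi.add_apply, Pi.smul_apply, smul_eq_mul]
  refine ⟨by rw [h₀, k₀], fun r p q => by linarith [key (h₁ r p q) (k₁ r p q)], key h₂ k₂,
    ⟨by linarith [key h₃ k₃], by linarith [key' h₄ k₄]⟩,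
    ⟨by linarith [key h₅ k₅], by linarith [key' h₆ k₆]⟩, key h₇ k₇, by linarith [key' h₈ k₈],
    by linarith [key' h₉ k₉], by linarith [key' h₁₀ k₁₀]⟩

theorem convex_PER : Convex ℝ PER := by
  rintro ⟨a, b, c⟩ ⟨h₁, h₂, h₃, h₄⟩ ⟨a', b', c'⟩ ⟨k₁, k₂, k₃, k₄⟩ s t hs ht -
  change (s * a + t * a') ^ 2 ≤ (s * b + t * b') * (s * c + t * c') ∧ 0 ≤ s * b + t * b' ∧
    s * b + t * b' ≤ s * a + t * a' ∧ s * a + t * a' ≤ s * c + t * c'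
  refine ⟨?_, ?_, ?_, ?_⟩
  -- AM-GM: `(2aa')² ≤ 4(bc')(b'c) ≤ (bc' + b'c)²`.
  · have hcross : 2 * (a * a') ≤ b * c' + b' * c := by
      have hc : 0 ≤ c := h₂.trans (h₃.trans h₄)
      have hc' : 0 ≤ c' := k₂.trans (k₃.trans k₄)
      have hmul : a ^ 2 * a' ^ 2 ≤ b * c * (b' * c') :=
        mul_le_mul h₁ k₁ (sq_nonneg _) (mul_nonneg h₂ hc)
      refine abs_le_of_sq_le_sq' ?_ (by positivity) |>.2
      nlinarith [sq_nonneg (b * c' - b' * c)]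
    nlinarith [mul_le_mul_of_nonneg_left h₁ (sq_nonneg s),
      mul_le_mul_of_nonneg_left k₁ (sq_nonneg t),
      mul_le_mul_of_nonneg_left hcross (mul_nonneg hs ht)]
  · positivity
  · gcongr
  · gcongr

theorem convex_perspectiveConstraint (j : Fin 2) : Convex ℝ (perspectiveConstraint j) := by
  rintro ⟨x, X, y, Y, α, β⟩ hp ⟨x', X', y', Y', α', β'⟩ hq s t hs ht hst
  have := convex_PER (show (α j, β j, y j - Y) ∈ PER from hp)
    (show (α' j, β' j, y' j - Y') ∈ PER from hq) hs ht hst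
  change (s * α j + t * α' j, s * β j + t * β' j, s * y j + t * y' j - (s * Y + t * Y')) ∈ PER
  rw [show s * y j + t * y' j - (s * Y + t * Y') = s * (y j - Y) + t * (y' j - Y') by ring]
  exact this

theorem convex_indicatorConstraint : Convex ℝ indicatorConstraint := by
  rintro ⟨x, X, y, Y, α, β⟩ hp ⟨x', X', y', Y', α', β'⟩ hq s t hs ht hst
  rw [mem_indicatorConstraint_iff] at hp hq
  obtain ⟨h₁, h₂, h₃, h₄⟩ := hp
  obtain ⟨k₁, k₂, k₃, k₄⟩ := hq
  simp only [Prod.smul_mk, Prod.mk_add_mk]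
  rw [mem_indicatorConstraint_iff]
  simp only [Pi.add_apply, Pi.smul_apply, smul_eq_mul]
  have key {u v u' v' : ℝ} (hu : u ≤ u') (hv : v ≤ v') : s * u + t * v ≤ s * u' + t * v' := by
    gcongr
  exact ⟨by positivity, by linarith [key h₂ k₂], key h₃ k₃, key h₄ k₄⟩

theorem convex_liftedSet : Convex ℝ liftedSet := by
  intro p hp q hq s t hs ht hst
  exact ⟨convex_boundConstraint hp.1 hq.1 hs ht hst,
    convex_matrixConstraint hp.2.1 hq.2.1 hs ht hst,
    fun j => convex_perspectiveConstraint j (hp.2.2.1 j) (hq.2.2.1 j) hs ht hst,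
    convex_indicatorConstraint hp.2.2.2 hq.2.2.2 hs ht hst⟩

theorem convex_proj_image_liftedSet : Convex ℝ (proj '' liftedSet) :=
  convex_liftedSet.is_linear_image ⟨fun _ _ => rfl, fun _ _ => rfl⟩

/-! ### The two inclusions -/

theorem hull_subset_proj_image : hull ⊆ proj '' liftedSet := by
  refine convexHull_min ?_ convex_proj_image_liftedSet
  rintro p ⟨x, y, hx, hxy, hy, rfl⟩
  -- The factor `y_j - y₁y₂` is the indicator of `y = e_j`.
  refine ⟨(x, Matrix.vecMulVec x x, y, y 0 * y 1, fun j => x j * (y j - y 0 * y 1),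
    fun j => x j ^ 2 * (y j - y 0 * y 1)), ⟨hxy, ?_, ?_, ?_⟩, rfl⟩
  all_goals
    have hx₀ : 0 ≤ x 0 := hx 0
    have hx₁ : 0 ≤ x 1 := hx 1
    have hxy₀ := hxy 0
    have hxy₁ := hxy 1
  · rw [mem_matrixConstraint_iff]
    simp only [Matrix.vecMulVec_apply]
    have zero_or {z : ℝ} (hz : 0 ≤ z) (hz' : z ≤ 0) : z = 0 := le_antisymm hz' hz
    rcases hy 0 with h₀ | h₀ <;> rcases hy 1 with h₁ | h₁ <;> rw [h₀] at hxy₀ <;>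
      rw [h₁] at hxy₁ <;> simp only [h₀, h₁]
    · simp [zero_or hx₀ hxy₀, zero_or hx₁ hxy₁]
    · simp [zero_or hx₀ hxy₀, sq]
    · simp [zero_or hx₁ hxy₁, sq]
    · refine ⟨by ring, fun r s t => ?_, by norm_num, ⟨?_, ?_⟩, ⟨?_, ?_⟩, ?_, ?_, ?_, ?_⟩
      · linarith [sq_nonneg (r + x 0 * s + x 1 * t)]
      all_goals nlinarith [mul_nonneg (sub_nonneg.2 hxy₀) (sub_nonneg.2 hxy₁)]
  · intro j
    have hxj : 0 ≤ x j := hx j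
    have hxj' : x j ≤ 1 := (hxy j).trans (by rcases hy j with h | h <;> simp [h])
    have hc : 0 ≤ y j - y 0 * y 1 := by
      fin_cases j <;> rcases hy 0 with h₀ | h₀ <;> rcases hy 1 with h₁ | h₁ <;> simp [h₀, h₁]
    refine ⟨by nlinarith, by positivity, ?_, ?_⟩
    · exact mul_le_mul_of_nonneg_right (by nlinarith) hc
    · exact mul_le_of_le_one_left hc hxj'
  · rw [mem_indicatorConstraint_iff]
    rcases hy 0 with h₀ | h₀ <;> rcases hy 1 with h₁ | h₁ <;> norm_num [h₀, h₁]

theorem proj_image_subset_hull : proj '' liftedSet ⊆ hull := by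
  rintro _ ⟨⟨x, X, y, Y, α, β⟩, ⟨-, hM, hP, hY⟩, rfl⟩
  rw [mem_matrixConstraint_iff] at hM
  rw [mem_indicatorConstraint_iff] at hY
  obtain ⟨h₀, h₁, h₂, ⟨h₃, h₄⟩, ⟨h₅, h₆⟩, h₇, h₈, h₉, h₁₀⟩ := hM
  obtain ⟨-, k₁, k₂, k₃⟩ := hY
  obtain ⟨p, hp, ep⟩ := exists_smul_eq_of_box h₃ h₄ h₅ h₆ h₇ h₈ h₉ h₁₀ h₁
  obtain ⟨q, hq, eq⟩ := exists_smul_eq_of_PER_fst (hP 0)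
  obtain ⟨q', hq', eq'⟩ := exists_smul_eq_of_PER_snd (hP 1)
  -- Weights of the slices `(1,1)`, `(1,0)`, `(0,1)`, `(0,0)`, in this order.
  have := combo_four_mem_hull hp hq hq' zero_mem_hull h₂ (sub_nonneg.2 k₂) (sub_nonneg.2 k₃)
    (w₄ := 1 - y 0 - y 1 + Y) (by linarith) (by ring)
  rw [ep, eq, eq', mkPt_zero, smul_zero, add_zero, add_mkPt, add_mkPt] at this
  convert this using 1
  simp only [proj, mkPt, Prod.mk.injEq]
  refine ⟨?_, ?_, ?_, by ring⟩
  · ext i; fin_cases i <;> simp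
  · ext i j; fin_cases i <;> fin_cases j <;> simp [h₀]
  · ext i; fin_cases i <;> simp

end SwitchHull

theorem theorem3p1 :
    SwitchHull.hull = SwitchHull.proj '' SwitchHull.liftedSet ∧
      Convex ℝ SwitchHull.boundConstraint ∧
      Convex ℝ SwitchHull.matrixConstraint ∧
      (∀ j, Convex ℝ (SwitchHull.perspectiveConstraint j)) ∧
      Convex ℝ SwitchHull.indicatorConstraint :=
  ⟨SwitchHull.hull_subset_proj_image.antisymm SwitchHull.proj_image_subset_hull,
    SwitchHull.convex_boundConstraint, SwitchHull.convex_matrixConstraint,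
    SwitchHull.convex_perspectiveConstraint, SwitchHull.convex_indicatorConstraint⟩
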